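/- Let $d$ be a positive integer and let $|\cdot|$ denote the Euclidean norm on $\mathbb{Z}^d\subseteq\mathbb{R}^d$. Let $\rho:[0,\infty)\to[0,\infty)$ be strictly increasing and concave with $\rho(0)=0$ and $$\lim_{\xi\to\infty}\frac{\rho(\xi)}{\xi}=0,$$ and assume that for every $\varepsilon>0$ there is $\tilde C_\varepsilon>0$ such that $$\tilde C_\varepsilon\,\frac{e^{\varepsilon\rho(\xi)}}{(1+\xi)^{d+1}}\ge 1\qquad\text{for all }\xi\ge 0.$$ For a bounded linear operator $A$ on the complex Hilbert space $\ell^2(\mathbb{Z}^d)$, write $A_{s,t}=\langle Ae_t,e_s\rangle$, $s,t\in\mathbb{Z}^d$, for its entries with respect to the standard orthonormal basis $(e_t)_{t\in\mathbb{Z}^d}$. Let $A$ be a bounded linear operator on $\ell^2(\mathbb{Z}^d)$ that has a bounded inverse $A^{-1}$, and suppose that for every $k>0$ there is $C_k>0$ such that $$|A_{s,t}|\le C_k\,e^{-k\rho(|s-t|)}\qquad\text{for all }s,t\in\mathbb{Z}^d.$$ Then for every $k>0$ there is $C'_k>0$ such that $$|(A^{-1})_{s,t}|\le C'_k\,e^{-k\rho(|s-t|)}\qquad\text{for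 all }s,t\in\mathbb{Z}^d.$$ -/

import Mathlib

noncomputable section

/-- The complex Hilbert space `ℓ²(ℤ^d)`. -/
abbrev EllTwo (d : ℕ) : Type := lp (fun _ : Fin d → ℤ => ℂ) 2

/-- The entry `A_{s,t} = ⟨A e_t, e_s⟩`, i.e. the `s`-th coordinate of `A e_t`, where `e_t` is
the standard orthonormal basis vector at `t`. -/
def matrixEntry {d : ℕ} (A : EllTwo d →L[ℂ] EllTwo d) (s t : Fin d → ℤ) : ℂ :=
  (A (lp.single 2 t (1 : ℂ)) : (Fin d → ℤ) → ℂ) s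

/-- The Euclidean norm `|x|` of a point of `ℤ^d ⊆ ℝ^d`. -/
def euclNorm {d : ℕ} (x : Fin d → ℤ) : ℝ :=
  ‖(WithLp.toLp 2 (fun i => (x i : ℝ)) : EuclideanSpace ℝ (Fin d))‖

/-- `|A_{s,t}| ≤ C_k e^{-k ρ(|s-t|)}` for every `k > 0`, with a constant `C_k > 0`
depending on `k` but not on `s, t`. -/
def HasSubexpDecay {d : ℕ} (ρ : ℝ → ℝ) (A : EllTwo d →L[ℂ] EllTwo d) : Prop :=
  ∀ k : ℝ, 0 < k → ∃ C : ℝ, 0 < C ∧ ∀ s t : Fin d → ℤ,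
    ‖matrixEntry A s t‖ ≤ C * Real.exp (-k * ρ (euclNorm (s - t)))

end

/-! A column of `A⁻¹` is shown to decay by conjugating `A` with a weight `m = exp φ`, `φ x = k (ρ (R
+ |x - t|) - ρ R)`, truncated to be bounded. If `e` is the basis vector at `t` and `h = m A⁻¹ e`,
then `A h - e` is the commutator of `A` and `m` applied to `A⁻¹ e`. Concavity dominates it by
convolution of `|h|` with a kernel `K R`, so Young's inequality gives `‖h‖ ≤ ‖A⁻¹‖ (1 + ‖K R‖₁
‖h‖)`. The shift `R` makes the perturbation small: `ρ ξ / ξ → 0` forces increments of `ρ` far out to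
vanish, so `‖K R‖₁ → 0` by dominated convergence. The price is a constant factor `exp (k ρ R)`. -/

section Convolution

variable {G : Type*} [AddCommGroup G]

/-- The translates of `‖h ·‖` as an element of the real `ℓ²` space. -/
noncomputable def normTranslate (h : lp (fun _ : G => ℂ) 2) (v : G) : lp (fun _ : G => ℝ) 2 :=
  ⟨fun s => ‖h (s - v)‖, by
    have hp : 0 < (2 : ENNReal).toReal := by norm_num
    have := (memℓp_gen_iff hp).1 (lp.memℓp h)
    refine (memℓp_gen_iff hp).2 ?_
    simpa [Function.comp_def] using (Equiv.subRight v).summable_iff.2 this⟩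

theorem normTranslate_apply (h : lp (fun _ : G => ℂ) 2) (v s : G) :
    (normTranslate h v : G → ℝ) s = ‖h (s - v)‖ := rfl

theorem norm_normTranslate (h : lp (fun _ : G => ℂ) 2) (v : G) : ‖normTranslate h v‖ = ‖h‖ := by
  have hp : 0 < (2 : ENNReal).toReal := by norm_num
  rw [lp.norm_eq_tsum_rpow hp, lp.norm_eq_tsum_rpow hp]
  congr 1
  simp only [normTranslate_apply, norm_norm]
  exact (Equiv.subRight v).tsum_eq (fun u => ‖h u‖ ^ (2 : ENNReal).toReal)

/-- Young's inequality `ℓ¹ * ℓ² ⊆ ℓ²`, for a function dominated by a convolution. -/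
theorem norm_le_tsum_mul_of_le_convolution {K : G → ℝ} (hK0 : ∀ v, 0 ≤ K v) (hK : Summable K)
    {g h : lp (fun _ : G => ℂ) 2} (hg : ∀ s, ‖g s‖ ≤ ∑' u, K (s - u) * ‖h u‖) :
    ‖g‖ ≤ (∑' v, K v) * ‖h‖ := by
  have hnorm : ∀ v, ‖K v • normTranslate h v‖ = K v * ‖h‖ := fun v => by
    rw [norm_smul, norm_normTranslate, Real.norm_of_nonneg (hK0 v)]
  have hsn : Summable fun v => ‖K v • normTranslate h v‖ := by
    simpa only [hnorm] using hK.mul_right _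
  have hs : Summable fun v => K v • normTranslate h v := hsn.of_norm
  have heval : ∀ s, (∑' v, K v • normTranslate h v : lp (fun _ : G => ℝ) 2) s
      = ∑' u, K (s - u) * ‖h u‖ := fun s => by
    have := (lp.evalCLM ℝ (fun _ : G => ℝ) 2 s).map_tsum hs
    refine this.trans ?_
    rw [← (Equiv.subLeft s).tsum_eq]
    refine tsum_congr fun u => ?_
    change K (s - u) * ‖h (s - (s - u))‖ = _
    rw [sub_sub_cancel]
  calc ‖g‖ ≤ ‖∑' v, K v • normTranslate h v‖ := by
        refine lp.norm_mono (by norm_num) fun s => ?_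
        rw [heval]
        exact (hg s).trans (Real.le_norm_self _)
    _ ≤ ∑' v, ‖K v • normTranslate h v‖ := norm_tsum_le_tsum_norm hsn
    _ = (∑' v, K v) * ‖h‖ := by simp only [hnorm, tsum_mul_right]

end Convolution

/-- An operator on `ℓ²` acts through its matrix. -/
theorem hasSum_matrixEntry_mul {d : ℕ} (A : EllTwo d →L[ℂ] EllTwo d) (f : EllTwo d)
    (s : Fin d → ℤ) : HasSum (fun u => matrixEntry A s u * f u) ((A f) s) := by
  have h := ((lp.evalCLM ℂ (fun _ : Fin d → ℤ => ℂ) 2 s).comp A).hasSum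
    (lp.hasSum_single (by norm_num) f)
  have heq : ∀ u, ((lp.evalCLM ℂ (fun _ : Fin d → ℤ => ℂ) 2 s).comp A) (lp.single 2 u (f u)) =
      matrixEntry A s u * f u := fun u => by
    have hu : (lp.single 2 u (f u) : EllTwo d) = f u • lp.single 2 u (1 : ℂ) := by
      rw [← lp.single_smul, smul_eq_mul, mul_one]
    rw [hu, map_smul, smul_eq_mul, mul_comm]
    rfl
  simp only [heq] at h
  exact h

/-- Multiplication of an `ℓ²` sequence by a bounded real function. -/
noncomputable def weightMul {d : ℕ} (m : (Fin d → ℤ) → ℝ) (B : ℝ) (hm : ∀ x, |m x| ≤ B) (f : EllTwo d) :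
    EllTwo d :=
  ⟨fun x => (m x : ℂ) * f x, by
    have hB : 0 ≤ B := (abs_nonneg _).trans (hm 0)
    refine ((lp.memℓp f).const_smul (B : ℂ)).mono' fun x => ?_
    simp only [Pi.smul_apply, smul_eq_mul, norm_mul, Complex.norm_real, Real.norm_eq_abs,
      abs_of_nonneg hB]
    gcongr
    exact hm x⟩

theorem weightMul_apply {d : ℕ} (m : (Fin d → ℤ) → ℝ) (B : ℝ) (hm : ∀ x, |m x| ≤ B)
    (f : EllTwo d) (x : Fin d → ℤ) : weightMul m B hm f x = (m x : ℂ) * f x := rfl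

/-- If conjugation by the weight `m` perturbs `A` by less than half of `1 / ‖A⁻¹‖`, then the
weighted columns of `A⁻¹` are bounded by `2 ‖A⁻¹‖`. -/
theorem weight_mul_norm_matrixEntry_inv_le {d : ℕ} (A : (EllTwo d →L[ℂ] EllTwo d)ˣ)
    (t : Fin d → ℤ) {m : (Fin d → ℤ) → ℝ} {B : ℝ} (hm0 : ∀ x, 0 < m x) (hmB : ∀ x, m x ≤ B)
    (hmt : m t = 1) {K : (Fin d → ℤ) → ℝ} (hK0 : ∀ v, 0 ≤ K v) (hK : Summable K)
    (hAK : ∀ s u, ‖matrixEntry (A : EllTwo d →L[ℂ] EllTwo d) s u‖ * |1 - m s / m u| ≤ K (s - u))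
    (hsmall : ‖((A⁻¹ : (EllTwo d →L[ℂ] EllTwo d)ˣ) : EllTwo d →L[ℂ] EllTwo d)‖ * ∑' v, K v
      ≤ 1 / 2) (s : Fin d → ℤ) :
    m s * ‖matrixEntry ((A⁻¹ : (EllTwo d →L[ℂ] EllTwo d)ˣ) : EllTwo d →L[ℂ] EllTwo d) s t‖
      ≤ 2 * ‖((A⁻¹ : (EllTwo d →L[ℂ] EllTwo d)ˣ) : EllTwo d →L[ℂ] EllTwo d)‖ := by
  set T : EllTwo d →L[ℂ] EllTwo d := (A : EllTwo d →L[ℂ] EllTwo d) with hT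
  set T' : EllTwo d →L[ℂ] EllTwo d :=
    ((A⁻¹ : (EllTwo d →L[ℂ] EllTwo d)ˣ) : EllTwo d →L[ℂ] EllTwo d) with hT'
  have hTT' : ∀ x, T (T' x) = x := fun x => by
    change (T * T') x = x
    rw [hT, hT', A.mul_inv]; rfl
  have hT'T : ∀ x, T' (T x) = x := fun x => by
    change (T' * T) x = x
    rw [hT, hT', A.inv_mul]; rfl
  set e : EllTwo d := lp.single 2 t (1 : ℂ) with he
  have hme : ∀ s, e s = m s * e s := fun s => by
    by_cases hst : s = t
    · subst hst; simp [hmt]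
    · simp [he, Pi.single_eq_of_ne hst]
  set h : EllTwo d := weightMul m B
    (fun x => (abs_of_pos (hm0 x)).trans_le (hmB x)) (T' e) with hh
  -- Since `e = m e` and `T T' e = e`, the left side is `(T m - m T) (T' e)`; dividing by `m u`
  -- rewrites it in terms of `h`.
  have hentry : ∀ s, (T h - e) s = ∑' u, matrixEntry T s u * (1 - m s / m u : ℝ) * h u := by
    intro s
    have h1 := (hasSum_matrixEntry_mul T h s).sub
      ((hasSum_matrixEntry_mul T (T' e) s).mul_left (m s : ℂ))
    rw [hTT', ← hme] at h1
    refine h1.tsum_eq.symm.trans (tsum_congr fun u => ?_)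
    have : (m u : ℂ) ≠ 0 := by exact_mod_cast (hm0 u).ne'
    rw [hh, weightMul_apply]
    push_cast
    field_simp
  have hg : ‖T h - e‖ ≤ (∑' v, K v) * ‖h‖ := by
    refine norm_le_tsum_mul_of_le_convolution hK0 hK fun s => ?_
    rw [hentry]
    have hsum : Summable fun u => K (s - u) * ‖h u‖ := by
      refine Summable.of_nonneg_of_le (fun u => mul_nonneg (hK0 _) (norm_nonneg _))
        (fun u => mul_le_mul_of_nonneg_left (lp.norm_apply_le_norm (by norm_num) h u) (hK0 _)) ?_
      exact ((Equiv.subLeft s).summable_iff.2 hK).mul_right ‖h‖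
    refine tsum_of_norm_bounded hsum.hasSum fun u => ?_
    rw [norm_mul, norm_mul, Complex.norm_real, Real.norm_eq_abs]
    exact mul_le_mul_of_nonneg_right (hAK s u) (norm_nonneg _)
  have he1 : ‖e‖ = 1 := by rw [he, lp.norm_single (by norm_num)]; simp
  have hh' : ‖h‖ ≤ ‖T'‖ * (1 + (∑' v, K v) * ‖h‖) := by
    calc ‖h‖ = ‖T' (e + (T h - e))‖ := by rw [add_sub_cancel, hT'T]
      _ ≤ ‖T'‖ * ‖e + (T h - e)‖ := T'.le_opNorm _
      _ ≤ ‖T'‖ * (1 + (∑' v, K v) * ‖h‖) := by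
        gcongr
        exact (norm_add_le _ _).trans (add_le_add he1.le hg)
  -- The term `‖h‖ / 2` can be absorbed because `h` is in `ℓ²` a priori: this is where boundedness
  -- of `m` matters.
  have hh2 : ‖h‖ ≤ 2 * ‖T'‖ := by
    nlinarith [mul_le_mul_of_nonneg_right hsmall (norm_nonneg h)]
  calc m s * ‖matrixEntry T' s t‖ = ‖h s‖ := by
        rw [hh, weightMul_apply, norm_mul, Complex.norm_real, Real.norm_of_nonneg (hm0 s).le]
        rfl
    _ ≤ ‖h‖ := lp.norm_apply_le_norm (by norm_num) h s
    _ ≤ _ := hh2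

/-! ### Euclidean norm and lattice sums -/

section EuclNorm

variable {d : ℕ}

theorem euclNorm_nonneg (x : Fin d → ℤ) : 0 ≤ euclNorm x := norm_nonneg _

theorem euclNorm_neg (x : Fin d → ℤ) : euclNorm (-x) = euclNorm x := by
  simp [euclNorm, EuclideanSpace.norm_eq]

theorem euclNorm_sub_comm (x y : Fin d → ℤ) : euclNorm (x - y) = euclNorm (y - x) := by
  rw [← euclNorm_neg, neg_sub]

theorem euclNorm_add_le (x y : Fin d → ℤ) : euclNorm (x + y) ≤ euclNorm x + euclNorm y := by
  unfold euclNorm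
  refine le_trans (le_of_eq ?_) (norm_add_le _ _)
  congr 1
  ext i
  simp

theorem abs_euclNorm_sub_le (x y : Fin d → ℤ) : |euclNorm x - euclNorm y| ≤ euclNorm (x - y) := by
  have h1 := euclNorm_add_le (x - y) y
  have h2 := euclNorm_add_le (y - x) x
  rw [euclNorm_sub_comm y x] at h2
  simp only [sub_add_cancel] at h1 h2
  rw [abs_le]
  constructor <;> linarith

theorem summable_euclNorm_inv_pow_of_forall_mem
    {L : Submodule ℤ (EuclideanSpace ℝ (Fin d))} [DiscreteTopology L] [IsZLattice ℝ L]
    (hmem : ∀ x : Fin d → ℤ,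
      (WithLp.toLp 2 (fun i => (x i : ℝ)) : EuclideanSpace ℝ (Fin d)) ∈ L) :
    Summable fun x : Fin d → ℤ => (euclNorm x)⁻¹ ^ (d + 1) := by
  have hrank : Module.finrank ℤ L < d + 1 := by
    rw [ZLattice.rank ℝ L, finrank_euclideanSpace_fin]
    exact Nat.lt_succ_self d
  let j : (Fin d → ℤ) → L := fun x => ⟨WithLp.toLp 2 (fun i => (x i : ℝ)), hmem x⟩
  have hinj : Function.Injective j := fun x y hxy => by
    have h := congrArg Subtype.val hxy
    ext i
    have h' := congrArg (fun z : EuclideanSpace ℝ (Fin d) => z i) h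
    simpa [j] using h'
  have hnorm : ∀ x, euclNorm x = ‖j x‖ := fun x => rfl
  simp only [hnorm]
  exact (ZLattice.summable_norm_pow_inv L (d + 1) hrank).comp_injective hinj

theorem summable_euclNorm_inv_pow (d : ℕ) :
    Summable fun x : Fin d → ℤ => (euclNorm x)⁻¹ ^ (d + 1) := by
  refine summable_euclNorm_inv_pow_of_forall_mem
    (L := Submodule.span ℤ (Set.range (EuclideanSpace.basisFun (Fin d) ℝ).toBasis)) fun x => ?_
  have : (WithLp.toLp 2 (fun i => (x i : ℝ)) : EuclideanSpace ℝ (Fin d)) =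
      ∑ i, x i • (EuclideanSpace.basisFun (Fin d) ℝ).toBasis i := by
    ext j
    simp [Pi.single_apply]
  rw [this]
  exact Submodule.sum_mem _ fun i _ =>
    Submodule.smul_mem _ _ (Submodule.subset_span (Set.mem_range_self i))

end EuclNorm

/-! ### Increments of concave functions -/

section ConcaveIncrement

variable {ρ : ℝ → ℝ}

/-- Both `x + c` and `y` are convex combinations of `x` and `y + c`, with the weights exchanged; the
two concavity inequalities add up to the claim. -/
theorem ConcaveOn.increment_antitone (hρ : ConcaveOn ℝ (Set.Ici 0) ρ) {x y c : ℝ} (hx : 0 ≤ x)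
    (hxy : x ≤ y) (hc : 0 ≤ c) : ρ (y + c) - ρ y ≤ ρ (x + c) - ρ x := by
  rcases hc.eq_or_lt with rfl | hc
  · simp
  have hL : 0 < y - x + c := by linarith
  have hmem : y + c ∈ Set.Ici (0 : ℝ) := by simp only [Set.mem_Ici]; linarith
  have hsum : (y - x) / (y - x + c) + c / (y - x + c) = 1 := by field_simp
  have ha : 0 ≤ (y - x) / (y - x + c) := div_nonneg (by linarith) hL.le
  have hb : 0 ≤ c / (y - x + c) := by positivity
  have h1 := hρ.2 hx hmem ha hb hsum
  have h2 := hρ.2 hx hmem hb ha (by rw [add_comm]; exact hsum)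
  simp only [smul_eq_mul] at h1 h2
  have e1 : (y - x) / (y - x + c) * x + c / (y - x + c) * (y + c) = x + c := by
    field_simp; ring
  have e2 : c / (y - x + c) * x + (y - x) / (y - x + c) * (y + c) = y := by
    field_simp; ring
  rw [e1] at h1
  rw [e2] at h2
  have e3 : (y - x) / (y - x + c) = 1 - c / (y - x + c) := by linarith
  rw [e3] at h1 h2
  linarith

theorem abs_increment_sub_le (hρ : ConcaveOn ℝ (Set.Ici 0) ρ) (hmono : MonotoneOn ρ (Set.Ici 0))
    {R a b c : ℝ} (hR : 0 ≤ R) (ha : 0 ≤ a) (hb : 0 ≤ b) (hc : |a - b| ≤ c) :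
    |(ρ (R + a) - ρ R) - (ρ (R + b) - ρ R)| ≤ ρ (R + c) - ρ R := by
  wlog hab : b ≤ a generalizing a b
  · rw [abs_sub_comm]
    exact this hb ha (by rwa [abs_sub_comm]) (le_of_not_ge hab)
  rw [abs_of_nonneg (sub_nonneg.2 hab)] at hc
  have h1 : ρ (R + b) ≤ ρ (R + a) :=
    hmono (by simp only [Set.mem_Ici]; linarith) (by simp only [Set.mem_Ici]; linarith)
      (by linarith)
  have h2 := hρ.increment_antitone hR (show R ≤ R + b by linarith) (sub_nonneg.2 hab)
  have h3 : ρ (R + (a - b)) ≤ ρ (R + c) :=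
    hmono (by simp only [Set.mem_Ici]; linarith) (by simp only [Set.mem_Ici]; linarith)
      (by linarith)
  rw [show R + b + (a - b) = R + a by ring] at h2
  rw [abs_of_nonneg (by linarith)]
  linarith

theorem tendsto_increment (hρ : ConcaveOn ℝ (Set.Ici 0) ρ) (hmono : MonotoneOn ρ (Set.Ici 0))
    (h0 : ρ 0 = 0) (hlim : Filter.Tendsto (fun ξ : ℝ => ρ ξ / ξ) Filter.atTop (nhds 0))
    {a : ℝ} (ha : 0 ≤ a) :
    Filter.Tendsto (fun R => ρ (R + a) - ρ R) Filter.atTop (nhds 0) := by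
  have hlim' : Filter.Tendsto (fun R => a * (ρ R / R)) Filter.atTop (nhds 0) := by
    simpa using hlim.const_mul a
  refine tendsto_of_tendsto_of_tendsto_of_le_of_le' tendsto_const_nhds hlim' ?_ ?_
  · filter_upwards [Filter.eventually_ge_atTop 0] with R hR
    exact sub_nonneg.2 (hmono hR (by simp only [Set.mem_Ici]; linarith) (by linarith))
  · filter_upwards [Filter.eventually_gt_atTop 0] with R hR
    rcases ha.eq_or_lt with rfl | ha
    · simp
    -- The slope on `[R, R + a]` is at most the slope `ρ R / R` of the chord from the origin.
    have := hρ.slope_anti_adjacent (x := 0) (y := R) (z := R + a) (by simp)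
      (by simp only [Set.mem_Ici]; linarith) hR (by linarith)
    rw [h0, sub_zero, sub_zero, add_sub_cancel_left, div_le_iff₀ ha] at this
    linarith

end ConcaveIncrement

theorem summable_exp_neg_euclNorm {d : ℕ} {ρ : ℝ → ℝ}
    (hρ_dom : ∃ C : ℝ, 0 < C ∧ ∀ ξ : ℝ, 0 ≤ ξ → 1 ≤ C * (Real.exp (ρ ξ) / (1 + ξ) ^ (d + 1))) :
    Summable fun v : Fin d → ℤ => Real.exp (-ρ (euclNorm v)) := by
  obtain ⟨C, hC, h⟩ := hρ_dom
  refine Summable.of_norm_bounded_eventually ((summable_euclNorm_inv_pow d).mul_left C) ?_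
  -- The origin is excluded: there `0⁻¹ = 0` makes the majorant vanish.
  refine (Set.finite_singleton (0 : Fin d → ℤ)).subset fun v hv => ?_
  by_contra hv0
  refine hv ?_
  change ‖Real.exp (-ρ (euclNorm v))‖ ≤ C * (euclNorm v)⁻¹ ^ (d + 1)
  have hpos : 0 < euclNorm v := by
    refine norm_pos_iff.2 fun h0 => hv0 ?_
    ext i
    have := congrArg (fun z : EuclideanSpace ℝ (Fin d) => z i) h0
    simpa using this
  have h1 := h _ hpos.le
  have hp : 0 < (1 + euclNorm v) ^ (d + 1) := by positivity
  have hp' : euclNorm v ^ (d + 1) ≤ (1 + euclNorm v) ^ (d + 1) := by gcongr; linarith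
  rw [← mul_div_assoc, le_div_iff₀ hp, one_mul] at h1
  rw [Real.norm_of_nonneg (Real.exp_pos _).le, Real.exp_neg, inv_pow, ← div_eq_mul_inv,
    inv_eq_one_div, div_le_div_iff₀ (Real.exp_pos _) (by positivity)]
  linarith

theorem abs_one_sub_exp_le {x y : ℝ} (h : |x| ≤ y) : |1 - Real.exp x| ≤ Real.exp y - 1 := by
  have hx := abs_le.1 h
  have h1 : Real.exp x ≤ Real.exp y := Real.exp_le_exp.2 hx.2
  have h2 : Real.exp (-y) ≤ Real.exp x := Real.exp_le_exp.2 hx.1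
  have h3 : 2 ≤ Real.exp y + Real.exp (-y) := by
    have := Real.one_le_cosh y
    rw [Real.cosh_eq] at this
    linarith
  rw [abs_le]
  constructor <;> linarith

/-- The convolution kernels that dominate the perturbation of an operator with entries at most
`C * exp (-(k + 1) ρ)` under conjugation by the weights `exp (k (ρ (R + |x - t|) - ρ R))` are
summable, and their sums tend to zero as `R → ∞`. -/
theorem tendsto_tsum_conjugationKernel {d : ℕ} {ρ : ℝ → ℝ} (hmono : MonotoneOn ρ (Set.Ici 0))
    (hρ : ConcaveOn ℝ (Set.Ici 0) ρ) (h0 : ρ 0 = 0)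
    (hlim : Filter.Tendsto (fun ξ : ℝ => ρ ξ / ξ) Filter.atTop (nhds 0))
    (hsum : Summable fun v : Fin d → ℤ => Real.exp (-ρ (euclNorm v)))
    {k C : ℝ} (hk : 0 < k) (hC : 0 < C) {K : ℝ → (Fin d → ℤ) → ℝ}
    (hK : ∀ R v, K R v = C * Real.exp (-(k + 1) * ρ (euclNorm v)) *
      (Real.exp (k * (ρ (R + euclNorm v) - ρ R)) - 1)) :
    (∀ R, 0 ≤ R → (∀ v, 0 ≤ K R v) ∧ Summable (K R)) ∧
      Filter.Tendsto (fun R => ∑' v, K R v) Filter.atTop (nhds 0) := by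
  have hnonneg : ∀ R, 0 ≤ R → ∀ v, 0 ≤ K R v := fun R hR v => by
    have hv := euclNorm_nonneg v
    have : 0 ≤ ρ (R + euclNorm v) - ρ R :=
      sub_nonneg.2 (hmono hR (by simp only [Set.mem_Ici]; linarith) (by linarith))
    rw [hK]
    exact mul_nonneg (by positivity) (sub_nonneg.2 (Real.one_le_exp (by positivity)))
  have hbound : ∀ R, 0 ≤ R → ∀ v, ‖K R v‖ ≤ C * Real.exp (-ρ (euclNorm v)) := fun R hR v => by
    have hv := euclNorm_nonneg v
    rw [Real.norm_of_nonneg (hnonneg R hR v), hK, mul_assoc]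
    gcongr
    have h1 := hρ.increment_antitone le_rfl hR hv
    rw [zero_add, h0, sub_zero] at h1
    calc Real.exp (-(k + 1) * ρ (euclNorm v)) * (Real.exp (k * (ρ (R + euclNorm v) - ρ R)) - 1)
        ≤ Real.exp (-(k + 1) * ρ (euclNorm v)) * Real.exp (k * ρ (euclNorm v)) := by
          gcongr
          refine (sub_le_self _ zero_le_one).trans ?_
          gcongr
      _ = Real.exp (-ρ (euclNorm v)) := by rw [← Real.exp_add]; congr 1; ring
  refine ⟨fun R hR => ⟨hnonneg R hR, .of_norm_bounded (hsum.mul_left C) (hbound R hR)⟩, ?_⟩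
  have := tendsto_tsum_of_dominated_convergence (f := K) (g := fun _ => (0 : ℝ))
    (𝓕 := Filter.atTop) (hsum.mul_left C) (fun v => ?_)
    (by filter_upwards [Filter.eventually_ge_atTop 0] with R hR using hbound R hR)
  · simpa using this
  · have h1 := (tendsto_increment hρ hmono h0 hlim (euclNorm_nonneg v)).const_mul k
    have h2 := ((Real.continuous_exp.tendsto _).comp h1).sub_const 1
    have h3 := h2.const_mul (C * Real.exp (-(k + 1) * ρ (euclNorm v)))
    simpa [Function.comp_def, hK] using h3

theorem proposition2p3 (d : ℕ) (ρ : ℝ → ℝ)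
    (hρ_maps : Set.MapsTo ρ (Set.Ici 0) (Set.Ici 0))
    (hρ_mono : StrictMonoOn ρ (Set.Ici 0))
    (hρ_conc : ConcaveOn ℝ (Set.Ici 0) ρ)
    (hρ_zero : ρ 0 = 0)
    (hρ_lim : Filter.Tendsto (fun ξ : ℝ => ρ ξ / ξ) Filter.atTop (nhds 0))
    (hρ_dom : ∀ ε : ℝ, 0 < ε → ∃ C : ℝ, 0 < C ∧ ∀ ξ : ℝ, 0 ≤ ξ →
      1 ≤ C * (Real.exp (ε * ρ ξ) / (1 + ξ) ^ (d + 1)))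
    (A : (EllTwo d →L[ℂ] EllTwo d)ˣ)
    (hA : HasSubexpDecay ρ (A : EllTwo d →L[ℂ] EllTwo d)) :
    HasSubexpDecay ρ ((A⁻¹ : (EllTwo d →L[ℂ] EllTwo d)ˣ) : EllTwo d →L[ℂ] EllTwo d) := by

  have hmono := hρ_mono.monotoneOn
  intro k hk
  -- The weight costs at most `exp (k ρ)`; the extra `1` leaves a summable `exp (-ρ)`.
  obtain ⟨C, hC, hAC⟩ := hA (k + 1) (by linarith)
  have hsum := summable_exp_neg_euclNorm (by simpa using hρ_dom 1 one_pos)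
  set K : ℝ → (Fin d → ℤ) → ℝ := fun R v => C * Real.exp (-(k + 1) * ρ (euclNorm v)) *
    (Real.exp (k * (ρ (R + euclNorm v) - ρ R)) - 1)
  obtain ⟨hK, hKlim⟩ := tendsto_tsum_conjugationKernel hmono hρ_conc hρ_zero hρ_lim hsum hk hC
    (K := K) (fun _ _ => rfl)
  set N := ‖((A⁻¹ : (EllTwo d →L[ℂ] EllTwo d)ˣ) : EllTwo d →L[ℂ] EllTwo d)‖ with hN
  have hNK : Filter.Tendsto (fun R => N * ∑' v, K R v) Filter.atTop (nhds 0) := by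
    simpa using hKlim.const_mul N
  -- `R` is fixed before `s` and `t`, so the final constant is uniform.
  obtain ⟨R, hRsmall, hR⟩ := ((hNK.eventually (Iio_mem_nhds (show (0 : ℝ) < 1 / 2 by norm_num))).and
    (Filter.eventually_ge_atTop 0)).exists
  refine ⟨2 * N * Real.exp (k * ρ R) + 1, by positivity, fun s t => ?_⟩
  set φ : (Fin d → ℤ) → ℝ := fun x => k * (ρ (R + euclNorm (x - t)) - ρ R) with hφ
  have hφt : φ t = 0 := by simp [hφ, euclNorm, EuclideanSpace.norm_eq]
  have hmem : ∀ x : Fin d → ℤ, R + euclNorm x ∈ Set.Ici (0 : ℝ) := fun x => by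
    have := euclNorm_nonneg x
    simp only [Set.mem_Ici]; linarith
  have hφ0 : ∀ x, 0 ≤ φ x := fun x => by
    refine mul_nonneg hk.le (sub_nonneg.2 (hmono hR (hmem _) ?_))
    linarith [euclNorm_nonneg (x - t)]
  -- Truncating at `φ s` bounds the weight, keeps its value at `s`, and preserves the modulus of
  -- continuity, as `min` with a constant is 1-Lipschitz.
  have hlip : ∀ x y, |min (φ x) (φ s) - min (φ y) (φ s)| ≤
      k * (ρ (R + euclNorm (x - y)) - ρ R) := fun x y => by
    refine (abs_min_sub_min_le_max _ _ _ _).trans ?_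
    rw [sub_self, abs_zero, max_eq_left (abs_nonneg _), hφ, ← mul_sub, abs_mul, abs_of_pos hk]
    refine mul_le_mul_of_nonneg_left (abs_increment_sub_le hρ_conc hmono hR (euclNorm_nonneg _)
      (euclNorm_nonneg _) ?_) hk.le
    simpa using abs_euclNorm_sub_le (x - t) (y - t)
  have key := weight_mul_norm_matrixEntry_inv_le A t (m := fun x => Real.exp (min (φ x) (φ s)))
    (B := Real.exp (φ s)) (K := K R) (fun x => Real.exp_pos _)
    (fun x => Real.exp_le_exp.2 (min_le_right _ _))
    (by simp [hφt, hφ0 s]) (hK R hR).1 (hK R hR).2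
    (fun x y => by
      rw [← Real.exp_sub]
      exact mul_le_mul (hAC x y) (abs_one_sub_exp_le (hlip x y)) (abs_nonneg _) (by positivity))
    hRsmall.le s
  simp only [min_self] at key
  rw [← hN, mul_comm, ← le_div_iff₀ (Real.exp_pos _)] at key
  have hle : ρ (euclNorm (s - t)) ≤ ρ (R + euclNorm (s - t)) :=
    hmono (euclNorm_nonneg _) (hmem _) (by linarith)
  calc ‖matrixEntry ((A⁻¹ : (EllTwo d →L[ℂ] EllTwo d)ˣ) : EllTwo d →L[ℂ] EllTwo d) s t‖
      ≤ 2 * N / Real.exp (φ s) := key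
    _ = 2 * N * Real.exp (k * ρ R) * Real.exp (-k * ρ (R + euclNorm (s - t))) := by
      rw [div_eq_mul_inv, ← Real.exp_neg, mul_assoc (2 * N), ← Real.exp_add]
      congr 2
      simp only [hφ]
      ring
    _ ≤ (2 * N * Real.exp (k * ρ R) + 1) * Real.exp (-k * ρ (euclNorm (s - t))) := by
      refine mul_le_mul (by linarith) (Real.exp_le_exp.2 ?_) (Real.exp_pos _).le (by positivity)
      nlinarith
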